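/- Let $\alpha>0$, and let $\varpi_\ell^{(\alpha)}$, $\ell=0,1,2,\dots$, be the Taylor coefficients at $0$ of $$G(z)=\Big(\frac{3\alpha+1}{2\alpha}-\frac{2\alpha+1}{\alpha}z+\frac{\alpha+1}{2\alpha}z^2\Big)^{\alpha}$$ (principal branch). Then $G(z)=\sum_{\ell\ge 0}\varpi_\ell^{(\alpha)}z^\ell$ for all complex $|z|<1$. For $u\in L^1(\mathbb R)$ (complex-valued) put $\widehat u(\omega)=\int_{\mathbb R}e^{i\omega t}u(t)\,dt$, and let $$\mathscr C^{2+\alpha}(\mathbb R)=\Big\{u\in L^1(\mathbb R):\ \int_{\mathbb R}(1+|\omega|)^{2+\alpha}|\widehat u(\omega)|\,d\omega<\infty\Big\}.$$ With $n$ the positive integer such that $n-1\le\alpha<n$, the Riemann–Liouville derivative of order $\alpha$ with lower limit $-\infty$ is $${}_{\mathrm{RL}}D^{\alpha}_{-\infty,t}u(t)=\frac1{\Gamma(n-\alpha)}\frac{d^n}{dt^n}\int_{-\infty}^{t}\frac{u(s)}{(t-s)^{\alpha-n+1}}\,ds ,$$ and for a step size $\tau>0$ the difference operator is $$\delta^{\alpha}_{-\infty,t}u(t)=\tau^{-\alpha}\sum_{\ell=0}^{\infty}\varpi_\ell^{(\alpha)}u(t-\ell\tau).$$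 Let $u\in\mathscr C^{2+\alpha}(\mathbb R)$. Then the integral in the definition of ${}_{\mathrm{RL}}D^{\alpha}_{-\infty,t}u$ converges absolutely for every $t\in\mathbb R$ and is an $n$ times continuously differentiable function of $t$, and $${}_{\mathrm{RL}}D^{\alpha}_{-\infty,t}u\big(t+\tfrac12\tau\big)=\delta^{\alpha}_{-\infty,t}u(t)+\mathcal O(\tau^2)$$ uniformly in $t$. Precisely, there is a constant $C$, depending on $\alpha$ and $u$ but not on $t$ or $\tau$, such that for every $\tau>0$ the series defining $\delta^{\alpha}_{-\infty,t}u(t)$ converges absolutely and $$\Big|{}_{\mathrm{RL}}D^{\alpha}_{-\infty,t}u\big(t+\tfrac12\tau\big)-\delta^{\alpha}_{-\infty,t}u(t)\Big|\le C\tau^2$$ for almost every $t\in\mathbb R$, and for every $t\in\mathbb R$ if $u$ is continuous. -/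

import Mathlib

open MeasureTheory

namespace MidpointRL

noncomputable section

/-- The Fourier transform `û(ω) = ∫ e^{iωt} u(t) dt`. -/
def fourierHat (u : ℝ → ℂ) (ω : ℝ) : ℂ :=
  ∫ t : ℝ, Complex.exp (Complex.I * (ω : ℂ) * (t : ℂ)) * u t

/-- The class `𝒞^s(ℝ)`: integrable functions `u` with `∫ (1 + |ω|)^s |û(ω)| dω < ∞`. -/
structure MemFourierClass (s : ℝ) (u : ℝ → ℂ) : Prop where
  integrable : Integrable u
  integrable_weighted : Integrable (fun ω : ℝ => (1 + |ω|) ^ s * ‖fourierHat u ω‖)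

/-- The number `n` of derivatives in the Riemann–Liouville derivative of order `α`: the positive
integer with `n - 1 ≤ α < n`. -/
def rlOrder (α : ℝ) : ℕ := ⌊α⌋₊ + 1

/-- The integrand `s ↦ u(s) / (x - s)^{α - n + 1}`. -/
def rlIntegrand (α : ℝ) (u : ℝ → ℂ) (x s : ℝ) : ℂ :=
  (((x - s) ^ ((rlOrder α : ℝ) - α - 1) : ℝ) : ℂ) * u s

/-- `x ↦ ∫_{-∞}^x u(s) / (x - s)^{α - n + 1} ds`. -/
def rlIntegral (α : ℝ) (u : ℝ → ℂ) (x : ℝ) : ℂ :=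
  ∫ s in Set.Iio x, rlIntegrand α u x s

/-- The Riemann–Liouville derivative of order `α` with lower limit `-∞`. -/
def rlDeriv (α : ℝ) (u : ℝ → ℂ) (t : ℝ) : ℂ :=
  ((1 / Real.Gamma ((rlOrder α : ℝ) - α) : ℝ) : ℂ) *
    iteratedDeriv (rlOrder α) (rlIntegral α u) t

/-- The generating function `G`, with the principal branch of the power. -/
def genFun (α : ℝ) (z : ℂ) : ℂ :=
  ((3 * (α : ℂ) + 1) / (2 * α) - (2 * (α : ℂ) + 1) / α * z
    + ((α : ℂ) + 1) / (2 * α) * z ^ 2) ^ (α : ℂ)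

/-- The Taylor coefficients of `G` at `0`. -/
def weight (α : ℝ) (l : ℕ) : ℂ :=
  iteratedDeriv l (genFun α) 0 / (l.factorial : ℂ)

/-- The difference operator `τ^{-α} ∑_{l ≥ 0} ϖ_l u(t - lτ)`. -/
def diffOp (α τ : ℝ) (u : ℝ → ℂ) (t : ℝ) : ℂ :=
  ((τ ^ (-α) : ℝ) : ℂ) * ∑' l : ℕ, weight α l * u (t - (l : ℝ) * τ)

end

end MidpointRL

namespace MidpointRL

/-! Both operators are Fourier multipliers, and the estimate is a comparison of their symbols. With
`c = (α + 1) / (2α)` the generating function factors as `G(z) = ((1 - z)(1 + c(1 - z)))^α`. For `|z|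
≤ 1`, `z ≠ 1`, both factors lie in the right half-plane, so the principal power splits. The binomial
coefficients of `(1 - z)^α` are absolutely summable, and the other factor is holomorphic on a disc
of radius greater than one. Hence `∑ |ϖ_l| < ∞` (`summable_norm_weight`), the series represents `G`
up to the unit circle, and the difference operator has symbol `τ^{-α} G(e^{iωτ})`.

Put `s = -iy`. Then `G(e^{-s}) = (s b(s))^α` with `b(s) = 1 + (c - 1/2)s + O(s²)`, and `c` is
exactly the value for which `α(c - 1/2) = 1/2`. So `b(s)^α = e^{s/2} + O(s²)`, where `e^{s/2}` is
the half-step shift. This gives an error of at most `K|y|^{2+α}` for all real `y ≠ 0`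
(`exists_symbol_bound`). Scaling `y = ωτ` turns it into `Kτ²|ω|^{2+α}`, which is integrable against
`|û|`.

It remains to show that the Riemann–Liouville derivative has symbol `(-iω)^α`
(`MemFourierClass.rlDeriv_eq`). The fractional integral of order `β = n - α` has the formal symbol
`(-iω)^{-β}`, possibly not integrable at low frequency. Its increments from the point 0 have an
integrable kernel, and one derivative brings the symbol to `(-iω)^{1-β}`; the other `n - 1`
derivatives pass under the integral. -/

/-! ### Absolute summability of Taylor coefficients -/

theorem choose_succ_mul (a : ℂ) (l : ℕ) :
    Ring.choose a (l + 1) * (l + 1) = Ring.choose a l * (a - l) := by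
  have h1 : ((l + 1).factorial : ℂ) ≠ 0 := by exact_mod_cast (l + 1).factorial_ne_zero
  have h0 : (l.factorial : ℂ) ≠ 0 := by exact_mod_cast l.factorial_ne_zero
  have e (n : ℕ) : (n.factorial : ℂ) * Ring.choose a n = (descPochhammer ℤ n).smeval a := by
    rw [Ring.descPochhammer_eq_factorial_smul_choose, nsmul_eq_mul]
  have h2 := e (l + 1)
  rw [descPochhammer_succ_right, Polynomial.smeval_mul, ← e l] at h2
  simp only [Polynomial.smeval_sub, Polynomial.smeval_X, Polynomial.smeval_natCast, pow_one,
    pow_zero, nsmul_eq_mul, mul_one] at h2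
  apply mul_left_cancel₀ h0
  rw [Nat.factorial_succ] at h2
  push_cast at h2
  linear_combination h2

/-- The right-hand side telescopes, so the partial sums from `L` on never exceed `b L / c`. -/
theorem summable_of_mul_le_sub {a b : ℕ → ℝ} {c : ℝ} (hc : 0 < c) (ha : ∀ l, 0 ≤ a l)
    (hb : ∀ l, 0 ≤ b l) (L : ℕ) (h : ∀ l, L ≤ l → c * a l ≤ b l - b (l + 1)) : Summable a := by
  rw [← summable_nat_add_iff L]
  refine summable_of_sum_range_le (c := b L / c) (fun l => ha _) fun N => ?_
  rw [le_div_iff₀ hc, mul_comm, Finset.mul_sum]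
  calc ∑ i ∈ Finset.range N, c * a (i + L)
      ≤ ∑ i ∈ Finset.range N, (b (i + L) - b (i + 1 + L)) := by
        refine Finset.sum_le_sum fun i _ => ?_
        have := h (i + L) (by omega)
        rwa [add_right_comm] at this
    _ = b (0 + L) - b (N + L) := Finset.sum_range_sub' (fun i => b (i + L)) N
    _ ≤ b L := by simpa using hb (N + L)

/-- The binomial coefficients of a positive real exponent are absolutely summable. -/
theorem summable_norm_choose {α : ℝ} (hα : 0 < α) :
    Summable fun l : ℕ => ‖Ring.choose (α : ℂ) l‖ := by
  -- For `l ≥ α` the recurrence reads `(l + 1)|C(α, l+1)| = (l - α)|C(α, l)|`, so `l|C(α, l)|` drops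
  -- by exactly `α|C(α, l)|` at each step.
  refine summable_of_mul_le_sub (b := fun l => l * ‖Ring.choose (α : ℂ) l‖) hα
    (fun _ => norm_nonneg _) (fun _ => by positivity) ⌈α⌉₊ fun l hl => ?_
  have hl : α ≤ l := Nat.ceil_le.mp hl
  have h := congrArg norm (choose_succ_mul (α : ℂ) l)
  rw [norm_mul, norm_mul] at h
  have h1 : ‖(l : ℂ) + 1‖ = (l : ℝ) + 1 := by
    exact_mod_cast Complex.norm_of_nonneg (by positivity : (0 : ℝ) ≤ (l : ℝ) + 1)
  have h2 : ‖(α : ℂ) - l‖ = l - α := by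
    rw [norm_sub_rev]
    exact_mod_cast Complex.norm_of_nonneg (by linarith : (0 : ℝ) ≤ (l : ℝ) - α)
  rw [h1, h2] at h
  push_cast
  linarith

theorem norm_taylorCoeff_one_sub_cpow (a : ℂ) (l : ℕ) :
    ‖iteratedDeriv l (fun z : ℂ => (1 - z) ^ a) 0 / (l.factorial : ℂ)‖ = ‖Ring.choose a l‖ := by
  have h0 : (l.factorial : ℂ) ≠ 0 := by exact_mod_cast l.factorial_ne_zero
  have h := iteratedDeriv_comp_neg l (fun z : ℂ => (1 + z) ^ a) 0
  simp only [← sub_eq_add_neg, neg_zero] at h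
  have h2 := (Complex.one_add_cpow_hasFPowerSeriesOnBall_zero (a := a)).factorial_smul 1 l
  rw [h, norm_div, norm_smul, norm_pow, norm_neg, norm_one, one_pow, one_mul, ← norm_div]
  congr 1
  rw [div_eq_iff h0]
  rw [binomialSeries_apply, ← iteratedDeriv_eq_iteratedFDeriv] at h2
  simp at h2
  rw [← h2]; ring

theorem summable_norm_taylorCoeff {f : ℂ → ℂ} {r : ℝ} (hr : 1 < r)
    (hf : DifferentiableOn ℂ f (Metric.ball 0 r)) :
    Summable fun l : ℕ => ‖iteratedDeriv l f 0 / (l.factorial : ℂ)‖ := by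
  have h := (Complex.hasSum_taylorSeries_on_ball hf
    (z := 1) (by simpa using hr)).summable.norm
  refine h.congr fun l => ?_
  simp [div_eq_inv_mul]

theorem summable_norm_taylorCoeff_mul {f g : ℂ → ℂ} (hf : AnalyticAt ℂ f 0)
    (hg : AnalyticAt ℂ g 0)
    (hfs : Summable fun l : ℕ => ‖iteratedDeriv l f 0 / (l.factorial : ℂ)‖)
    (hgs : Summable fun l : ℕ => ‖iteratedDeriv l g 0 / (l.factorial : ℂ)‖) :
    Summable fun l : ℕ => ‖iteratedDeriv l (f * g) 0 / (l.factorial : ℂ)‖ := by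
  refine (summable_norm_sum_mul_antidiagonal_of_summable_norm hfs hgs).congr fun l => ?_
  congr 1
  rw [iteratedDeriv_mul hf.contDiffAt hg.contDiffAt, Finset.sum_div,
    Finset.Nat.sum_antidiagonal_eq_sum_range_succ
      (fun i j => iteratedDeriv i f 0 / (i.factorial : ℂ) *
        (iteratedDeriv j g 0 / (j.factorial : ℂ)))]
  refine Finset.sum_congr rfl fun i hi => ?_
  have hi : i ≤ l := Nat.lt_succ_iff.mp (Finset.mem_range.mp hi)
  have hc : ((l.choose i : ℂ)) * i.factorial * (l - i).factorial = l.factorial := by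
    exact_mod_cast Nat.choose_mul_factorial_mul_factorial hi
  have h1 : (l.factorial : ℂ) ≠ 0 := by exact_mod_cast l.factorial_ne_zero
  have h2 : (i.factorial : ℂ) ≠ 0 := by exact_mod_cast i.factorial_ne_zero
  have h3 : ((l - i).factorial : ℂ) ≠ 0 := by exact_mod_cast (l - i).factorial_ne_zero
  rw [div_mul_div_comm, div_eq_div_iff (mul_ne_zero h2 h3) h1]
  rw [← hc]; ring

/-! ### Factorization of the generating function and its series on the closed disc -/

/-- The slope `c` in the factorization `G(z) = ((1 - z) (1 + c (1 - z)))^α`. -/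
noncomputable def slope (α : ℝ) : ℝ := (α + 1) / (2 * α)

theorem slope_pos {α : ℝ} (hα : 0 < α) : 0 < slope α := by unfold slope; positivity

theorem genFun_eq {α : ℝ} (hα : 0 < α) (z : ℂ) :
    genFun α z = ((1 - z) * (1 + slope α * (1 - z))) ^ (α : ℂ) := by
  have h : (α : ℂ) ≠ 0 := by exact_mod_cast hα.ne'
  unfold genFun slope
  congr 1
  push_cast
  field_simp
  ring

/-- Both numbers lie in the open right half-plane, so each argument is below `π/2` in absolute
value. This keeps the product off the branch cut and makes `log` additive. -/
theorem arg_add_arg_mem {w : ℂ} (hw : 0 < w.re) {c : ℝ} (hc : 0 < c) :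
    w.arg + (1 + c * w).arg ∈ Set.Ioo (-Real.pi) Real.pi := by
  have h2 : 0 < (1 + c * w).re := by simp; positivity
  have a1 := abs_lt.mp (Complex.abs_arg_lt_pi_div_two_iff.mpr (Or.inl hw))
  have a2 := abs_lt.mp (Complex.abs_arg_lt_pi_div_two_iff.mpr (Or.inl h2))
  constructor <;> linarith [a1.1, a1.2, a2.1, a2.2]

theorem ne_zero_of_re_pos {w : ℂ} (hw : 0 < w.re) : w ≠ 0 := by
  rintro rfl; simp at hw

theorem one_add_mul_re_pos {w : ℂ} (hw : 0 < w.re) {c : ℝ} (hc : 0 < c) :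
    0 < (1 + c * w).re := by
  simp; positivity

theorem mul_mem_slitPlane {w : ℂ} (hw : 0 < w.re) {c : ℝ} (hc : 0 < c) :
    w * (1 + c * w) ∈ Complex.slitPlane := by
  have h1 := ne_zero_of_re_pos hw
  have h2 := ne_zero_of_re_pos (one_add_mul_re_pos hw hc)
  have h := arg_add_arg_mem hw hc
  rw [Complex.mem_slitPlane_iff_arg, Complex.arg_mul h1 h2 ⟨h.1, h.2.le⟩]
  exact ⟨h.2.ne, mul_ne_zero h1 h2⟩

theorem mul_cpow_of_re_pos {w : ℂ} (hw : 0 < w.re) {c : ℝ} (hc : 0 < c) (a : ℂ) :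
    (w * (1 + c * w)) ^ a = w ^ a * (1 + c * w) ^ a := by
  have h1 := ne_zero_of_re_pos hw
  have h2 := ne_zero_of_re_pos (one_add_mul_re_pos hw hc)
  have h := arg_add_arg_mem hw hc
  rw [Complex.cpow_def_of_ne_zero (mul_ne_zero h1 h2), Complex.cpow_def_of_ne_zero h1,
    Complex.cpow_def_of_ne_zero h2, Complex.log_mul h1 h2 ⟨h.1, h.2.le⟩, add_mul, Complex.exp_add]

theorem one_sub_re_pos {z : ℂ} (hz : ‖z‖ ≤ 1) (h1 : z ≠ 1) : 0 < (1 - z).re := by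
  have h := Complex.re_le_norm z
  rcases (h.trans hz).lt_or_eq with h2 | h2
  · simpa using h2
  · exfalso
    apply h1
    have h3 : Complex.normSq z ≤ 1 := by
      rw [Complex.normSq_eq_norm_sq]; exact pow_le_one₀ (norm_nonneg _) hz
    rw [Complex.normSq_apply, h2] at h3
    have : z.im = 0 := by nlinarith
    exact Complex.ext h2 this

theorem ne_one_of_norm_lt {z : ℂ} (hz : ‖z‖ < 1) : z ≠ 1 := by
  rintro rfl; simp at hz

theorem differentiableOn_genFun {α : ℝ} (hα : 0 < α) :
    DifferentiableOn ℂ (genFun α) (Metric.ball 0 1) := by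
  rw [funext (genFun_eq hα)]
  intro z hz
  have hz : ‖z‖ < 1 := by simpa using hz
  refine (DifferentiableAt.cpow_const (f := fun z => (1 - z) * (1 + slope α * (1 - z)))
    (by fun_prop) ?_).differentiableWithinAt
  exact mul_mem_slitPlane (one_sub_re_pos hz.le (ne_one_of_norm_lt hz)) (slope_pos hα)

theorem hasSum_weight {α : ℝ} (hα : 0 < α) {z : ℂ} (hz : ‖z‖ < 1) :
    HasSum (fun l : ℕ => weight α l * z ^ l) (genFun α z) := by
  have h := Complex.hasSum_taylorSeries_on_ball (differentiableOn_genFun hα)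
    (z := z) (by simpa using hz)
  have e : (fun l : ℕ => weight α l * z ^ l) =
      fun l : ℕ => (l.factorial : ℂ)⁻¹ • (z - 0) ^ l • iteratedDeriv l (genFun α) 0 := by
    funext l
    simp only [weight, smul_eq_mul, sub_zero]
    ring
  rwa [e]

theorem summable_norm_weight {α : ℝ} (hα : 0 < α) : Summable fun l : ℕ => ‖weight α l‖ := by
  have hc := slope_pos hα
  set c := slope α
  -- `Re z < 1 + 1/c` is precisely the condition for `1 + c(1 - z)` to have positive real part, so
  -- the principal power is holomorphic on this disc.
  have hg : DifferentiableOn ℂ (fun z : ℂ => (1 + c * (1 - z)) ^ (α : ℂ))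
      (Metric.ball 0 (1 + 1 / c)) := by
    intro z hz
    have hz : ‖z‖ < 1 + 1 / c := by simpa using hz
    refine (DifferentiableAt.cpow_const (by fun_prop) (Or.inl ?_)).differentiableWithinAt
    have h := (Complex.re_le_norm z).trans_lt hz
    have h' : c * z.re < c * (1 + 1 / c) := by gcongr
    have : c * (1 + 1 / c) = c + 1 := by field_simp
    simp
    linarith
  have hfs : Summable fun l : ℕ =>
      ‖iteratedDeriv l (fun z : ℂ => (1 - z) ^ (α : ℂ)) 0 / (l.factorial : ℂ)‖ := by
    simpa only [norm_taylorCoeff_one_sub_cpow] using summable_norm_choose hα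
  have hf : AnalyticAt ℂ (fun z : ℂ => (1 - z) ^ (α : ℂ)) 0 :=
    AnalyticAt.cpow (by fun_prop) (by fun_prop) (by simp)
  have hr : 1 < 1 + 1 / c := by simp [hc]
  have h := summable_norm_taylorCoeff_mul hf (hg.analyticAt (Metric.ball_mem_nhds _ (by linarith)))
    hfs (summable_norm_taylorCoeff hr hg)
  refine h.congr fun l => ?_
  unfold weight
  congr 2
  refine Filter.EventuallyEq.iteratedDeriv_eq l ?_
  filter_upwards [Metric.ball_mem_nhds (0 : ℂ) one_pos] with z hz
  have hz : ‖z‖ < 1 := by simpa using hz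
  rw [genFun_eq hα, mul_cpow_of_re_pos (one_sub_re_pos hz.le (ne_one_of_norm_lt hz)) hc]
  rfl

theorem continuousOn_genFun {α : ℝ} (hα : 0 < α) :
    ContinuousOn (genFun α) (Metric.closedBall 0 1) := by
  rw [funext (genFun_eq hα)]
  intro z hz
  have hz : ‖z‖ ≤ 1 := by simpa using hz
  refine ContinuousAt.continuousWithinAt ?_
  by_cases h1 : z = 1
  · subst h1
    -- At `z = 1` the base vanishes, on the edge of the branch cut; continuity survives because the
    -- exponent has positive real part.
    have h : ContinuousAt (fun x : ℂ × ℂ => x.1 ^ x.2)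
        (((1 - 1) * (1 + slope α * (1 - 1)) : ℂ), (α : ℂ)) := by
      simpa using Complex.continuousAt_cpow_zero_of_re_pos (z := (α : ℂ)) (by simpa using hα)
    exact ContinuousAt.comp (f := fun z : ℂ => ((1 - z) * (1 + slope α * (1 - z)), (α : ℂ)))
      h (by fun_prop)
  · exact ContinuousAt.cpow (f := fun z => (1 - z) * (1 + slope α * (1 - z))) (by fun_prop)
      continuousAt_const (mul_mem_slitPlane (one_sub_re_pos hz h1) (slope_pos hα))

/-- Absolute summability makes the series continuous on the closed disc, so its identity with `G`
passes from the open disc to the closure. The boundary circle is where the symbol is evaluated. -/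
theorem hasSum_weight_closedBall {α : ℝ} (hα : 0 < α) {z : ℂ} (hz : ‖z‖ ≤ 1) :
    HasSum (fun l : ℕ => weight α l * z ^ l) (genFun α z) := by
  have hb (l : ℕ) (w : ℂ) (hw : w ∈ Metric.closedBall (0 : ℂ) 1) :
      ‖weight α l * w ^ l‖ ≤ ‖weight α l‖ := by
    have hw : ‖w‖ ≤ 1 := by simpa using hw
    rw [norm_mul, norm_pow]
    exact mul_le_of_le_one_right (norm_nonneg _) (pow_le_one₀ (norm_nonneg _) hw)
  have hz' : z ∈ Metric.closedBall (0 : ℂ) 1 := by simpa using hz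
  have hs : Summable (fun l : ℕ => weight α l * z ^ l) :=
    Summable.of_norm_bounded (summable_norm_weight hα) fun l => hb l z hz'
  have hcont : ContinuousOn (fun w => ∑' l : ℕ, weight α l * w ^ l) (Metric.closedBall 0 1) :=
    continuousOn_tsum (fun l => by fun_prop) (summable_norm_weight hα) hb
  have heq : Set.EqOn (fun w => ∑' l : ℕ, weight α l * w ^ l) (genFun α)
      (closure (Metric.ball (0 : ℂ) 1)) := by
    refine Set.EqOn.of_subset_closure (s := Metric.ball (0 : ℂ) 1) (fun w hw =>
      (hasSum_weight hα (by simpa using hw)).tsum_eq) ?_ ?_ subset_closure subset_rfl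
    · rwa [closure_ball _ one_ne_zero]
    · rw [closure_ball _ one_ne_zero]; exact continuousOn_genFun hα
  rw [closure_ball _ one_ne_zero] at heq
  rw [← heq hz']
  exact hs.hasSum

/-! ### Second order consistency of the symbol -/

open Asymptotics Filter Topology

/-- The quotient `G(e^{-s})^{1/α} / s`. -/
noncomputable def symbolBase (α : ℝ) (s : ℂ) : ℂ :=
  (1 - Complex.exp (-s)) / s * (1 + slope α * (1 - Complex.exp (-s)))

theorem one_sub_exp_neg_isBigO :
    (fun s : ℂ => 1 - Complex.exp (-s) - (s - s ^ 2 / 2)) =O[𝓝 0] fun s => s ^ 3 := by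
  refine IsBigO.of_bound 1 ?_
  filter_upwards [Metric.closedBall_mem_nhds (0 : ℂ) one_pos] with s hs
  have hs : ‖-s‖ ≤ 1 := by simpa using hs
  have h := Complex.exp_bound hs (n := 3) (by norm_num)
  simp only [Finset.sum_range_succ, Finset.sum_range_zero, norm_neg] at h
  rw [norm_pow, ← norm_neg]
  refine le_trans (le_of_eq ?_) (h.trans ?_)
  · congr 1
    simp [Nat.factorial]
    ring
  · rw [mul_comm]
    gcongr
    norm_num [Nat.factorial]

theorem symbolBase_isBigO (α : ℝ) :
    (fun s : ℂ => symbolBase α s - 1 - (slope α - 1 / 2) * s) =O[𝓝[≠] 0] fun s => s ^ 2 := by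
  have hw : (fun s : ℂ => (1 - Complex.exp (-s)) / s - 1 + s / 2) =O[𝓝[≠] 0] fun s => s ^ 2 := by
    have h := (one_sub_exp_neg_isBigO.mono nhdsWithin_le_nhds (l := 𝓝[≠] 0)).mul
      (isBigO_refl (fun s : ℂ => s⁻¹) (𝓝[≠] 0))
    refine h.congr' ?_ ?_ <;> filter_upwards [self_mem_nhdsWithin] with s hs
    · have hs : s ≠ 0 := hs
      field_simp
      ring
    · have hs : s ≠ 0 := hs
      field_simp
  have hs1 : (fun s : ℂ => s) =O[𝓝[≠] 0] fun _ => (1 : ℂ) :=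
    (continuousAt_id (x := (0 : ℂ))).isBigO_one ℂ |>.mono nhdsWithin_le_nhds
  have hs2 : (fun s : ℂ => s ^ 2) =O[𝓝[≠] 0] fun s => s := by
    simpa [pow_two] using hs1.mul (isBigO_refl (fun s : ℂ => s) (𝓝[≠] 0))
  have hq : (fun s : ℂ => (1 - Complex.exp (-s)) / s - 1) =O[𝓝[≠] 0] fun s => s := by
    have h2 : (fun s : ℂ => s / 2) =O[𝓝[≠] 0] fun s => s := by
      simpa [div_eq_inv_mul] using (isBigO_refl (fun s : ℂ => s) (𝓝[≠] 0)).const_mul_left (2⁻¹)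
    simpa using (hw.trans hs2).sub h2
  have hq1 : (fun s : ℂ => (1 - Complex.exp (-s)) / s + 1) =O[𝓝[≠] 0] fun _ => (1 : ℂ) := by
    have := (hq.trans hs1).add (isBigO_const_const (2 : ℂ) (one_ne_zero (α := ℂ)) (𝓝[≠] 0))
    refine this.congr_left fun s => ?_
    ring
  have h3 := ((hq.mul hq1).mul (isBigO_refl (fun s : ℂ => s) (𝓝[≠] 0))).const_mul_left
    (slope α : ℂ)
  refine (hw.add (h3.congr_right fun s => by ring)).congr' ?_ EventuallyEq.rfl
  filter_upwards [self_mem_nhdsWithin] with s hs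
  have hs : s ≠ 0 := hs
  unfold symbolBase
  field_simp
  ring

theorem symbolBase_sub_one_isBigO (α : ℝ) :
    (fun s : ℂ => symbolBase α s - 1) =O[𝓝[≠] 0] fun s => s := by
  have hs1 : (fun s : ℂ => s) =O[𝓝[≠] 0] fun _ => (1 : ℂ) :=
    (continuousAt_id (x := (0 : ℂ))).isBigO_one ℂ |>.mono nhdsWithin_le_nhds
  have hs2 : (fun s : ℂ => s ^ 2) =O[𝓝[≠] 0] fun s => s := by
    simpa [pow_two] using hs1.mul (isBigO_refl (fun s : ℂ => s) (𝓝[≠] 0))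
  simpa using ((symbolBase_isBigO α).trans hs2).add
    ((isBigO_refl (fun s : ℂ => s) (𝓝[≠] 0)).const_mul_left (slope α - 1 / 2 : ℂ))

theorem tendsto_symbolBase (α : ℝ) : Tendsto (symbolBase α) (𝓝[≠] 0) (𝓝 1) := by
  have h := (symbolBase_sub_one_isBigO α).trans_tendsto
    (tendsto_id.mono_left nhdsWithin_le_nhds)
  simpa using h.add_const 1

theorem symbolBase_cpow_sub_exp_isBigO {α : ℝ} (hα : 0 < α) :
    (fun s : ℂ => symbolBase α s ^ (α : ℂ) - Complex.exp (s / 2)) =O[𝓝[≠] 0] fun s => s ^ 2 := by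
  have hb : Tendsto (fun s => symbolBase α s - 1) (𝓝[≠] 0) (𝓝 0) := by
    simpa using (tendsto_symbolBase α).sub_const 1
  have h1 : (fun s => Complex.log (1 + (symbolBase α s - 1)) - (symbolBase α s - 1))
      =O[𝓝[≠] 0] fun s => s ^ 2 :=
    (Complex.log_sub_self_isBigO.comp_tendsto hb).trans ((symbolBase_sub_one_isBigO α).pow 2)
  -- The coefficient of `s` in `α log b(s)` must match that of `s/2`: this fixes the slope and
  -- yields the second order.
  have hc : (α : ℂ) * (slope α - 1 / 2) = 1 / 2 := by
    have : (α : ℂ) ≠ 0 := by exact_mod_cast hα.ne'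
    unfold slope
    push_cast
    field_simp
    ring
  have h2 : (fun s => α * Complex.log (symbolBase α s) - s / 2) =O[𝓝[≠] 0] fun s => s ^ 2 := by
    refine ((h1.add (symbolBase_isBigO α)).const_mul_left (α : ℂ)).congr_left fun s => ?_
    rw [add_sub_cancel]
    linear_combination -s * hc
  have hs2 : Tendsto (fun s : ℂ => s ^ 2) (𝓝[≠] 0) (𝓝 0) := by
    have : Tendsto (fun s : ℂ => s ^ 2) (𝓝 0) (𝓝 (0 ^ 2)) :=
      Continuous.tendsto (by fun_prop) 0
    simpa using this.mono_left nhdsWithin_le_nhds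
  have h3 : (fun z : ℂ => Complex.exp z - 1) =O[𝓝 0] fun z => z := by
    simpa using (Complex.hasDerivAt_exp 0).isBigO_sub
  have h4 := (h3.comp_tendsto (h2.trans_tendsto hs2)).trans h2
  have h5 : (fun s : ℂ => Complex.exp (s / 2)) =O[𝓝[≠] 0] fun _ => (1 : ℂ) :=
    (by fun_prop : ContinuousAt (fun s : ℂ => Complex.exp (s / 2)) 0).isBigO_one ℂ
      |>.mono nhdsWithin_le_nhds
  refine (h5.mul h4).congr' ?_ (by simp)
  filter_upwards [(tendsto_symbolBase α).eventually_ne one_ne_zero] with s hs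
  rw [Complex.cpow_def_of_ne_zero hs]
  simp only [Function.comp]
  rw [mul_sub, ← Complex.exp_add, mul_one]
  congr 2
  ring

/-- The argument of `s` is `±π/2` and that of `b` is strictly smaller in absolute value, so their
sum stays inside `(-π, π)`. -/
theorem mul_cpow_of_re_eq_zero {s b : ℂ} (hs : s ≠ 0) (hs0 : s.re = 0) (hb : 0 < b.re) (a : ℂ) :
    (s * b) ^ a = s ^ a * b ^ a := by
  have h2 := ne_zero_of_re_pos hb
  have a1 := abs_le.mp (Complex.abs_arg_le_pi_div_two_iff.mpr hs0.ge)
  have a2 := abs_lt.mp (Complex.abs_arg_lt_pi_div_two_iff.mpr (Or.inl hb))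
  rw [Complex.cpow_def_of_ne_zero (mul_ne_zero hs h2), Complex.cpow_def_of_ne_zero hs,
    Complex.cpow_def_of_ne_zero h2, Complex.log_mul hs h2, add_mul, Complex.exp_add]
  constructor <;> linarith [a1.1, a1.2, a2.1, a2.2]

theorem norm_genFun_le {α : ℝ} (hα : 0 < α) {z : ℂ} (hz : ‖z‖ ≤ 1) :
    ‖genFun α z‖ ≤ ∑' l : ℕ, ‖weight α l‖ := by
  rw [← (hasSum_weight_closedBall hα hz).tsum_eq]
  refine tsum_of_norm_bounded (summable_norm_weight hα).hasSum fun l => ?_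
  rw [norm_mul, norm_pow]
  exact mul_le_of_le_one_right (norm_nonneg _) (pow_le_one₀ (norm_nonneg _) hz)

theorem norm_exp_I_mul_real (y : ℝ) : ‖Complex.exp (Complex.I * y)‖ = 1 := by
  rw [mul_comm]; exact Complex.norm_exp_ofReal_mul_I y

/-- Second order consistency of the symbol on the imaginary axis. -/
theorem exists_symbol_bound {α : ℝ} (hα : 0 < α) : ∃ K : ℝ, 0 ≤ K ∧ ∀ y : ℝ, y ≠ 0 →
    ‖(-(Complex.I * y)) ^ (α : ℂ) * Complex.exp (-(Complex.I * y) / 2)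
      - genFun α (Complex.exp (Complex.I * y))‖ ≤ K * |y| ^ (2 + α) := by
  obtain ⟨K₁, hK₁, hO⟩ := (symbolBase_cpow_sub_exp_isBigO hα).exists_pos
  have hre : ∀ᶠ s in 𝓝[≠] (0 : ℂ), 0 < (symbolBase α s).re :=
    (Complex.continuous_re.tendsto 1).comp (tendsto_symbolBase α) |>.eventually_const_lt (by simp)
  obtain ⟨ε, hε, hball⟩ := Metric.mem_nhdsWithin_iff.mp (hO.bound.and hre)
  set W := ∑' l : ℕ, ‖weight α l‖
  have hW : 0 ≤ W := tsum_nonneg fun _ => norm_nonneg _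
  have hns (y : ℝ) : ‖-(Complex.I * y)‖ = |y| := by simp
  -- `K₁` serves `|y| < ε`. For `|y| ≥ ε` the two symbols are bounded separately, by `|y|^α` and
  -- `W`, using `1 ≤ (|y|/ε)²` and `1 ≤ (|y|/ε)^{2+α}`.
  refine ⟨K₁ + ((ε ^ 2)⁻¹ + W * (ε ^ (2 + α))⁻¹), by positivity, fun y hy => ?_⟩
  have hy0 : 0 < |y| := abs_pos.mpr hy
  have hpow : |y| ^ (2 + α) = |y| ^ 2 * |y| ^ α := by
    rw [Real.rpow_add hy0]; norm_cast
  rw [add_mul]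
  rcases lt_or_ge |y| ε with hlt | hge
  · set s : ℂ := -(Complex.I * y) with hs
    have hs0 : s ≠ 0 := by simp [hs, hy]
    obtain ⟨hb, hr⟩ := hball (a := s)
      ⟨by rw [mem_ball_zero_iff, hs, hns]; exact hlt, hs0⟩
    have hG : genFun α (Complex.exp (Complex.I * y)) = (s * symbolBase α s) ^ (α : ℂ) := by
      rw [genFun_eq hα, ← neg_neg (Complex.I * y), ← hs]
      unfold symbolBase
      congr 1
      field_simp
    rw [hG, mul_cpow_of_re_eq_zero hs0 (by simp [hs]) hr, ← mul_sub, norm_mul,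
      Complex.norm_cpow_real, hns, norm_sub_rev, hpow]
    rw [norm_pow, hns] at hb
    calc |y| ^ α * _ ≤ |y| ^ α * (K₁ * |y| ^ 2) := by gcongr
      _ = K₁ * (|y| ^ 2 * |y| ^ α) + 0 := by ring
      _ ≤ _ := by gcongr; positivity
  · have h1 : ‖(-(Complex.I * y)) ^ (α : ℂ) * Complex.exp (-(Complex.I * y) / 2)‖
        ≤ (ε ^ 2)⁻¹ * |y| ^ (2 + α) := by
      rw [norm_mul, Complex.norm_cpow_real, hns, Complex.norm_exp, hpow]
      have : (-(Complex.I * y) / 2 : ℂ).re = 0 := by simp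
      rw [this, Real.exp_zero, mul_one, ← mul_assoc]
      refine le_mul_of_one_le_left (by positivity) ?_
      rw [inv_mul_eq_div, one_le_div (by positivity)]
      gcongr
    have h2 : ‖genFun α (Complex.exp (Complex.I * y))‖ ≤ W * (ε ^ (2 + α))⁻¹ * |y| ^ (2 + α) := by
      refine (norm_genFun_le hα (norm_exp_I_mul_real y).le).trans ?_
      rw [mul_assoc]
      refine le_mul_of_one_le_right hW ?_
      rw [inv_mul_eq_div, one_le_div (by positivity)]
      gcongr
    calc _ ≤ _ := norm_sub_le _ _
      _ ≤ 0 + ((ε ^ 2)⁻¹ * |y| ^ (2 + α) + W * (ε ^ (2 + α))⁻¹ * |y| ^ (2 + α)) := by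
        rw [zero_add]; exact add_le_add h1 h2
      _ ≤ _ := by rw [add_mul]; gcongr; positivity

/-! ### Fourier inversion almost everywhere -/

section Inversion

open FourierTransform

theorem integral_fourier_smul_eq_of_integrable {f g : ℝ → ℂ} (hf : Integrable f)
    (hg : Integrable g) : ∫ x, 𝓕 f x • g x = ∫ x, f x • 𝓕 g x := by
  simpa using! VectorFourier.integral_bilin_fourierIntegral_eq_flip
    (ContinuousLinearMap.lsmul ℂ ℂ) (L := innerₗ ℝ)
    Real.continuous_fourierChar continuous_inner hf hg

/-- Fourier inversion almost everywhere. -/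
theorem fourier_fourierInv_ae_eq {f : ℝ → ℂ} (hf : Integrable f) (hf' : Integrable (𝓕⁻ f)) :
    𝓕 (𝓕⁻ f) =ᵐ[volume] f := by
  have hcont : Continuous (𝓕 (𝓕⁻ f)) :=
    VectorFourier.fourierIntegral_continuous Real.continuous_fourierChar continuous_inner hf'
  -- Tested against a smooth compactly supported function, both transforms can be moved onto the
  -- test function, where inversion holds in the Schwartz space.
  refine ae_eq_of_integral_contDiff_smul_eq hcont.locallyIntegrable hf.locallyIntegrable
    fun g hg hgs => ?_
  let φ : SchwartzMap ℝ ℂ := HasCompactSupport.toSchwartzMap (f := fun x => (g x : ℂ))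
    (hgs.comp_left (g := fun x : ℝ => (x : ℂ)) Complex.ofReal_zero)
    (Complex.ofRealCLM.contDiff.comp hg)
  have hφ (x : ℝ) : φ x = (g x : ℂ) := rfl
  have e (h : ℝ → ℂ) : ∫ x, g x • h x = ∫ x, φ x • h x := by
    simp only [hφ]; rfl
  rw [e, e, ← integral_fourier_smul_eq_of_integrable φ.integrable hf']
  rw [Real.fourierInv_eq_fourier_comp_neg, ← SchwartzMap.fourier_coe,
    ← integral_fourier_smul_eq_of_integrable (𝓕 φ).integrable hf.comp_neg]
  rw [← integral_neg_eq_self]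
  refine integral_congr_ae (ae_of_all _ fun x => ?_)
  have h : 𝓕⁻ (𝓕 φ) x = φ x := by simp
  simp only [neg_neg]
  rw [← h, SchwartzMap.fourierInv_coe, Real.fourierInv_eq_fourier_neg]

end Inversion

/-- The continuous representative `(2π)⁻¹ ∫ e^{-iωx} û(ω) dω` of `u`. -/
noncomputable def invHat (u : ℝ → ℂ) (x : ℝ) : ℂ :=
  ((2 * Real.pi)⁻¹ : ℝ) * ∫ ω : ℝ, Complex.exp (-(Complex.I * ω * x)) * fourierHat u ω

open FourierTransform in
theorem fourierHat_two_pi_mul (u : ℝ → ℂ) (y : ℝ) :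
    fourierHat u (2 * Real.pi * y) = 𝓕⁻ u y := by
  rw [Real.fourierInv_eq', fourierHat]
  refine integral_congr_ae (ae_of_all _ fun t => ?_)
  simp only [smul_eq_mul]
  congr 2
  simp
  ring

open FourierTransform in
theorem invHat_eq (u : ℝ → ℂ) : invHat u = 𝓕 (𝓕⁻ u) := by
  funext x
  rw [Real.fourier_real_eq_integral_exp_smul]
  have h := Measure.integral_comp_mul_left
    (fun ω : ℝ => Complex.exp (-(Complex.I * ω * x)) * fourierHat u ω) (2 * Real.pi)
  rw [abs_of_pos (by positivity)] at h
  rw [invHat, ← Complex.real_smul, ← h]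
  refine integral_congr_ae (ae_of_all _ fun t => ?_)
  simp only [fourierHat_two_pi_mul, smul_eq_mul]
  congr 2
  push_cast
  ring

theorem invHat_ae_eq {u : ℝ → ℂ} (hu : Integrable u) (hu' : Integrable (fourierHat u)) :
    invHat u =ᵐ[volume] u := by
  rw [invHat_eq]
  refine fourier_fourierInv_ae_eq hu ?_
  have h := hu'.comp_mul_left' (R := 2 * Real.pi) (by positivity)
  simpa only [fourierHat_two_pi_mul] using h

theorem norm_exp_neg_I_mul (ω x : ℝ) : ‖Complex.exp (-(Complex.I * ω * x))‖ = 1 := by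
  rw [Complex.norm_exp]; simp

theorem continuous_fourierHat {u : ℝ → ℂ} (hu : Integrable u) : Continuous (fourierHat u) := by
  refine continuous_of_dominated (bound := fun t => ‖u t‖) (fun ω => ?_) (fun ω => ?_) hu.norm ?_
  · exact (by fun_prop : Continuous fun t : ℝ =>
      Complex.exp (Complex.I * ω * t)).aestronglyMeasurable.mul hu.aestronglyMeasurable
  · refine ae_of_all _ fun t => ?_
    rw [norm_mul, Complex.norm_exp]
    simp
  · exact ae_of_all _ fun t => by fun_prop

/-! ### Oscillatory integrals and their derivatives -/

/-- The oscillatory integral `∫ e^{-iωx} g(ω) dω`. -/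
noncomputable def oscInt (g : ℝ → ℂ) (x : ℝ) : ℂ :=
  ∫ ω : ℝ, Complex.exp (-(Complex.I * ω * x)) * g ω

theorem integrable_exp_mul {g : ℝ → ℂ} (hg : Integrable g) (x : ℝ) :
    Integrable fun ω : ℝ => Complex.exp (-(Complex.I * ω * x)) * g ω :=
  hg.bdd_mul (c := 1)
    (by fun_prop : Continuous fun ω : ℝ => Complex.exp (-(Complex.I * ω * x))).aestronglyMeasurable
    (ae_of_all _ fun ω => (norm_exp_neg_I_mul ω x).le)

theorem hasDerivAt_exp_neg_I_mul (ω x : ℝ) :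
    HasDerivAt (fun x : ℝ => Complex.exp (-(Complex.I * ω * x)))
      (Complex.exp (-(Complex.I * ω * x)) * -(Complex.I * ω)) x := by
  have h : HasDerivAt (fun x : ℝ => -(Complex.I * ω * x)) (-(Complex.I * ω)) x := by
    simpa using ((Complex.ofRealCLM.hasDerivAt (x := x)).const_mul (Complex.I * ω)).fun_neg
  exact h.cexp

theorem hasDerivAt_oscInt {g : ℝ → ℂ} (hg : Integrable g)
    (hg' : Integrable fun ω : ℝ => -(Complex.I * ω) * g ω) (x : ℝ) :
    HasDerivAt (oscInt g) (oscInt (fun ω : ℝ => -(Complex.I * ω) * g ω) x) x := by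
  refine (hasDerivAt_integral_of_dominated_loc_of_deriv_le (μ := volume)
    (F := fun (x : ℝ) (ω : ℝ) => Complex.exp (-(Complex.I * ω * x)) * g ω)
    (F' := fun (x : ℝ) (ω : ℝ) => Complex.exp (-(Complex.I * ω * x)) * (-(Complex.I * ω) * g ω))
    (bound := fun ω => ‖-(Complex.I * ω) * g ω‖) univ_mem
    (Eventually.of_forall fun y => (integrable_exp_mul hg y).aestronglyMeasurable)
    (integrable_exp_mul hg x) (integrable_exp_mul hg' x).aestronglyMeasurable
    (ae_of_all _ fun ω y _ => ?_) hg'.norm (ae_of_all _ fun ω y _ => ?_)).2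
  · rw [norm_mul, norm_exp_neg_I_mul, one_mul]
  · simpa only [mul_assoc] using (hasDerivAt_exp_neg_I_mul ω y).mul_const (g ω)

theorem iteratedDeriv_oscInt {g : ℝ → ℂ} {N : ℕ}
    (hg : ∀ k ≤ N, Integrable fun ω : ℝ => (-(Complex.I * ω)) ^ k * g ω) {m : ℕ} (hm : m ≤ N) :
    iteratedDeriv m (oscInt g) = oscInt fun ω : ℝ => (-(Complex.I * ω)) ^ m * g ω := by
  induction m with
  | zero => simp
  | succ m ih =>
    rw [iteratedDeriv_succ, ih (by omega)]
    funext x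
    have e : (fun ω : ℝ => (-(Complex.I * ω)) ^ (m + 1) * g ω) =
        fun ω : ℝ => -(Complex.I * ω) * ((-(Complex.I * ω)) ^ m * g ω) := by
      funext ω; ring
    have h := hg (m + 1) hm
    rw [e] at h ⊢
    exact (hasDerivAt_oscInt (hg m (by omega)) h x).deriv

/-- The extra moment `N + 1` makes the `N`-th derivative differentiable, which supplies its
continuity. -/
theorem contDiff_oscInt {g : ℝ → ℂ} {N : ℕ}
    (hg : ∀ k ≤ N + 1, Integrable fun ω : ℝ => (-(Complex.I * ω)) ^ k * g ω) :
    ContDiff ℝ N (oscInt g) := by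
  refine contDiff_of_differentiable_iteratedDeriv (n := (N : ℕ∞)) fun m hm x => ?_
  have hm : m ≤ N := by exact_mod_cast hm
  rw [iteratedDeriv_oscInt hg (by omega : m ≤ N + 1)]
  refine (hasDerivAt_oscInt (hg m (by omega)) ?_ x).differentiableAt
  refine (hg (m + 1) (by omega)).congr (ae_of_all _ fun ω => ?_)
  ring

theorem invHat_eq_oscInt (u : ℝ → ℂ) (x : ℝ) :
    invHat u x = ((2 * Real.pi)⁻¹ : ℝ) * oscInt (fourierHat u) x := rfl

theorem continuous_oscInt {g : ℝ → ℂ} (hg : Integrable g) : Continuous (oscInt g) :=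
  continuous_of_dominated (bound := fun ω => ‖g ω‖)
    (fun x => (integrable_exp_mul hg x).aestronglyMeasurable)
    (fun x => ae_of_all _ fun ω => by rw [norm_mul, norm_exp_neg_I_mul, one_mul]) hg.norm
    (ae_of_all _ fun ω => by fun_prop)

theorem norm_oscInt_le (g : ℝ → ℂ) (x : ℝ) : ‖oscInt g x‖ ≤ ∫ ω, ‖g ω‖ := by
  refine (norm_integral_le_integral_norm _).trans (le_of_eq ?_)
  simp only [norm_mul, norm_exp_neg_I_mul, one_mul]

/-! ### Euler's integral with complex parameter -/

section Gamma

theorem integrableOn_rpow_mul_exp_neg {β c : ℝ} (hβ : 0 < β) (hc : 0 < c) :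
    IntegrableOn (fun r : ℝ => r ^ (β - 1) * Real.exp (-(c * r))) (Set.Ioi 0) := by
  simpa using integrableOn_rpow_mul_exp_neg_mul_rpow (p := 1) (s := β - 1) (by linarith)
    one_pos hc

theorem norm_rpow_mul_cexp {r : ℝ} (hr : 0 < r) (a : ℝ) (p : ℂ) :
    ‖((r ^ a : ℝ) : ℂ) * Complex.exp (-(p * r))‖ = r ^ a * Real.exp (-(p.re * r)) := by
  rw [norm_mul, Complex.norm_exp, Complex.norm_real, Real.norm_of_nonneg (by positivity)]
  simp

theorem aestronglyMeasurable_rpow_mul_cexp (a : ℝ) (p : ℂ) :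
    AEStronglyMeasurable (fun r : ℝ => ((r ^ a : ℝ) : ℂ) * Complex.exp (-(p * r)))
      (volume.restrict (Set.Ioi 0)) := by
  refine Measurable.aestronglyMeasurable ?_
  fun_prop

theorem integrableOn_rpow_mul_cexp {β : ℝ} (hβ : 0 < β) {p : ℂ} (hp : 0 < p.re) :
    IntegrableOn (fun r : ℝ => ((r ^ (β - 1) : ℝ) : ℂ) * Complex.exp (-(p * r))) (Set.Ioi 0) := by
  refine (integrableOn_rpow_mul_exp_neg hβ hp).mono' (aestronglyMeasurable_rpow_mul_cexp _ _) ?_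
  filter_upwards [ae_restrict_mem measurableSet_Ioi] with r hr
  rw [norm_rpow_mul_cexp hr]

theorem differentiableAt_gammaLaplace {β : ℝ} (hβ : 0 < β) {p : ℂ} (hp : 0 < p.re) :
    DifferentiableAt ℂ
      (fun p : ℂ => ∫ r in Set.Ioi (0 : ℝ), ((r ^ (β - 1) : ℝ) : ℂ) * Complex.exp (-(p * r))) p := by
  refine (hasDerivAt_integral_of_dominated_loc_of_deriv_le (μ := volume.restrict (Set.Ioi 0))
    (F := fun (p : ℂ) (r : ℝ) => ((r ^ (β - 1) : ℝ) : ℂ) * Complex.exp (-(p * r)))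
    (F' := fun (p : ℂ) (r : ℝ) =>
      ((r ^ (β - 1) : ℝ) : ℂ) * (Complex.exp (-(p * r)) * (-r)))
    -- Restricting to `Re q > Re p / 2` gives a majorant uniform in `q`; the exponent `β + 1`
    -- absorbs the factor `r` produced by differentiation.
    (bound := fun r => r ^ (β + 1 - 1) * Real.exp (-(p.re / 2 * r)))
    (s := {q : ℂ | p.re / 2 < q.re})
    ((isOpen_lt continuous_const Complex.continuous_re).mem_nhds
      (by change p.re / 2 < p.re; linarith))
    (Eventually.of_forall fun q => aestronglyMeasurable_rpow_mul_cexp _ _)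
    (integrableOn_rpow_mul_cexp hβ hp) ?_ ?_
    (integrableOn_rpow_mul_exp_neg (by linarith) (by linarith)) ?_).2.differentiableAt
  · refine Measurable.aestronglyMeasurable ?_
    fun_prop
  · filter_upwards [ae_restrict_mem measurableSet_Ioi] with r hr q hq
    have hr : 0 < r := hr
    have hq : p.re / 2 < q.re := hq
    rw [← mul_assoc, norm_mul, norm_rpow_mul_cexp hr, norm_neg, Complex.norm_real,
      Real.norm_of_nonneg hr.le, add_sub_right_comm, Real.rpow_add_one hr.ne']
    rw [mul_right_comm]
    gcongr
  · refine ae_of_all _ fun r q _ => ?_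
    have h : HasDerivAt (fun q : ℂ => -(q * r)) (-r : ℂ) q := by
      simpa using ((hasDerivAt_id q).mul_const (r : ℂ)).fun_neg
    exact h.cexp.const_mul _

/-- Euler's integral `∫₀^∞ r^{β-1} e^{-pr} dr = Γ(β) p^{-β}` for `Re p > 0`. -/
theorem integral_rpow_mul_cexp {β : ℝ} (hβ : 0 < β) {p : ℂ} (hp : 0 < p.re) :
    ∫ r in Set.Ioi (0 : ℝ), ((r ^ (β - 1) : ℝ) : ℂ) * Complex.exp (-(p * r))
      = Real.Gamma β * p ^ (-β : ℂ) := by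
  let U : Set ℂ := {q | 0 < q.re}
  have hU : IsOpen U := isOpen_lt continuous_const Complex.continuous_re
  have hconv : Convex ℝ U := convex_halfSpace_re_gt 0
  -- Both sides are analytic in the right half-plane and agree on the positive reals, which
  -- accumulate at 1; the identity theorem does the rest.
  have hf : AnalyticOnNhd ℂ (fun p : ℂ =>
      ∫ r in Set.Ioi (0 : ℝ), ((r ^ (β - 1) : ℝ) : ℂ) * Complex.exp (-(p * r))) U :=
    DifferentiableOn.analyticOnNhd
      (fun q hq => (differentiableAt_gammaLaplace hβ hq).differentiableWithinAt) hU
  have hg : AnalyticOnNhd ℂ (fun p : ℂ => Real.Gamma β * p ^ (-β : ℂ)) U := by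
    refine DifferentiableOn.analyticOnNhd (fun q hq => ?_) hU
    exact ((DifferentiableAt.cpow_const (f := fun q : ℂ => q) differentiableAt_id
      (Or.inl hq)).const_mul _).differentiableWithinAt
  refine hf.eqOn_of_preconnected_of_frequently_eq hg hconv.isPreconnected
    (z₀ := ((1 : ℝ) : ℂ)) (by simp [U]) ?_ hp
  have ht : Tendsto (fun t : ℝ => (t : ℂ)) (𝓝[≠] 1) (𝓝[≠] ((1 : ℝ) : ℂ)) :=
    tendsto_nhdsWithin_iff.mpr ⟨
      Complex.continuous_ofReal.continuousAt.tendsto.mono_left nhdsWithin_le_nhds,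
      by filter_upwards [self_mem_nhdsWithin] with t ht; simpa using ht⟩
  refine ht.frequently (Eventually.frequently ?_)
  filter_upwards [nhdsWithin_le_nhds (Ioi_mem_nhds one_pos)] with r hr
  have hr : 0 < r := hr
  have h := Complex.integral_cpow_mul_exp_neg_mul_Ioi (a := (β : ℂ)) (by simpa using hβ) hr
  have e : ∫ t in Set.Ioi (0 : ℝ), ((t ^ (β - 1) : ℝ) : ℂ) * Complex.exp (-((r : ℂ) * t))
      = ∫ t in Set.Ioi (0 : ℝ), (t : ℂ) ^ ((β : ℂ) - 1) * Complex.exp (-((r : ℂ) * t)) := by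
    refine setIntegral_congr_fun measurableSet_Ioi fun t ht => ?_
    have ht : 0 < t := ht
    rw [Complex.ofReal_cpow ht.le]
    push_cast
    rfl
  rw [e, h, Complex.Gamma_ofReal, mul_comm, one_div,
    Complex.inv_cpow _ _ (by rw [Complex.arg_ofReal_of_nonneg hr.le]; exact Real.pi_pos.ne),
    ← Complex.cpow_neg]

end Gamma

/-! ### Integrability of the weighted transform -/

theorem norm_neg_I_mul_cpow (ω a : ℝ) : ‖(-(Complex.I * ω)) ^ (a : ℂ)‖ = |ω| ^ a := by
  rw [Complex.norm_cpow_real]; simp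

theorem measurable_neg_I_mul_cpow (a : ℂ) :
    Measurable fun ω : ℝ => (-(Complex.I * ω)) ^ a := by
  fun_prop

theorem neg_I_mul_ne_zero {ω : ℝ} (hω : ω ≠ 0) : -(Complex.I * ω) ≠ 0 := by
  simp [hω]

theorem ae_ne_zero : ∀ᵐ ω : ℝ, ω ≠ 0 := by
  simp [ae_iff, measure_singleton]

theorem MemFourierClass.integrable_rpow {s : ℝ} {u : ℝ → ℂ} (hu : MemFourierClass s u) {a : ℝ}
    (ha : 0 ≤ a) (has : a ≤ s) : Integrable fun ω : ℝ => |ω| ^ a * ‖fourierHat u ω‖ := by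
  refine hu.integrable_weighted.mono' ?_ (ae_of_all _ fun ω => ?_)
  · exact (by fun_prop : Measurable fun ω : ℝ => |ω| ^ a).aestronglyMeasurable.mul
      (continuous_fourierHat hu.integrable).norm.aestronglyMeasurable
  · rw [Real.norm_of_nonneg (by positivity)]
    gcongr
    calc |ω| ^ a ≤ (1 + |ω|) ^ a := by gcongr; linarith
      _ ≤ (1 + |ω|) ^ s := Real.rpow_le_rpow_of_exponent_le (by linarith [abs_nonneg ω]) has

theorem MemFourierClass.integrable_cpow {s : ℝ} {u : ℝ → ℂ} (hu : MemFourierClass s u) {a : ℝ}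
    (ha : 0 ≤ a) (has : a ≤ s) :
    Integrable fun ω : ℝ => (-(Complex.I * ω)) ^ (a : ℂ) * fourierHat u ω := by
  refine (hu.integrable_rpow ha has).mono' ?_ (ae_of_all _ fun ω => ?_)
  · exact (measurable_neg_I_mul_cpow _).aestronglyMeasurable.mul
      (continuous_fourierHat hu.integrable).aestronglyMeasurable
  · rw [norm_mul, norm_neg_I_mul_cpow]

theorem MemFourierClass.integrable_fourierHat {s : ℝ} (hs : 0 ≤ s) {u : ℝ → ℂ}
    (hu : MemFourierClass s u) : Integrable (fourierHat u) := by
  simpa using hu.integrable_cpow le_rfl hs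

theorem pow_mul_cpow_ae_eq (g : ℝ → ℂ) (k : ℕ) (a : ℝ) :
    (fun ω : ℝ => (-(Complex.I * ω)) ^ k * ((-(Complex.I * ω)) ^ (a : ℂ) * g ω)) =ᵐ[volume]
      fun ω : ℝ => (-(Complex.I * ω)) ^ ((k + a : ℝ) : ℂ) * g ω := by
  filter_upwards [ae_ne_zero] with ω hω
  rw [← mul_assoc, Complex.ofReal_add, Complex.cpow_add _ _ (neg_I_mul_ne_zero hω),
    Complex.ofReal_natCast, Complex.cpow_natCast]

theorem oscInt_congr_ae {f g : ℝ → ℂ} (h : f =ᵐ[volume] g) : oscInt f = oscInt g := by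
  funext x
  refine integral_congr_ae ?_
  filter_upwards [h] with ω hω
  rw [hω]

/-! ### Fractional integrals of oscillatory integrals -/

/-- Order `β` of the fractional integral in the Riemann–Liouville derivative. -/
noncomputable def rlFrac (α : ℝ) : ℝ := (rlOrder α : ℝ) - α

theorem rlFrac_pos {α : ℝ} : 0 < rlFrac α := by
  have := Nat.lt_floor_add_one α
  unfold rlFrac rlOrder
  push_cast
  linarith

theorem rlFrac_le_one {α : ℝ} (hα : 0 < α) : rlFrac α ≤ 1 := by
  have := Nat.floor_le hα.le
  unfold rlFrac rlOrder
  push_cast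
  linarith

/-- The fractional integral `∫₀^∞ r^{β-1} v(x - r) dr`. -/
noncomputable def fracInt (β : ℝ) (v : ℝ → ℂ) (x : ℝ) : ℂ :=
  ∫ r in Set.Ioi (0 : ℝ), ((r ^ (β - 1) : ℝ) : ℂ) * v (x - r)

/-- On `(0, 1]` the kernel is integrable and `v` is bounded; beyond 1 the kernel is at most 1, since
`β ≤ 1`, and `v` is integrable. -/
theorem integrableOn_fracInt {β M : ℝ} (hβ : 0 < β) (hβ1 : β ≤ 1) {v : ℝ → ℂ}
    (hv : Integrable v) (hM : ∀ x, ‖v x‖ ≤ M) (x : ℝ) :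
    IntegrableOn (fun r : ℝ => ((r ^ (β - 1) : ℝ) : ℂ) * v (x - r)) (Set.Ioi 0) := by
  have hv' : Integrable fun r => v (x - r) := hv.comp_sub_left x
  have hmeas : AEStronglyMeasurable (fun r : ℝ => ((r ^ (β - 1) : ℝ) : ℂ) * v (x - r)) :=
    (by fun_prop : Measurable fun r : ℝ => ((r ^ (β - 1) : ℝ) : ℂ)).aestronglyMeasurable.mul
      hv'.aestronglyMeasurable
  rw [← Set.Ioc_union_Ioi_eq_Ioi zero_le_one]
  refine IntegrableOn.union ?_ ?_
  · have h : IntegrableOn (fun r : ℝ => r ^ (β - 1)) (Set.Ioc 0 1) := by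
      rw [← intervalIntegrable_iff_integrableOn_Ioc_of_le zero_le_one]
      exact intervalIntegral.intervalIntegrable_rpow' (by linarith)
    refine (h.mul_const M).mono' hmeas.restrict ?_
    filter_upwards [ae_restrict_mem measurableSet_Ioc] with r hr
    have hr0 : 0 < r := hr.1
    rw [norm_mul, Complex.norm_real, Real.norm_of_nonneg (by positivity)]
    gcongr
    exact hM _
  · refine hv'.norm.integrableOn.mono' hmeas.restrict ?_
    filter_upwards [ae_restrict_mem measurableSet_Ioi] with r hr
    have hr1 : 1 < r := hr
    rw [norm_mul, Complex.norm_real, Real.norm_of_nonneg (by positivity)]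
    exact mul_le_of_le_one_left (norm_nonneg _)
      (Real.rpow_le_one_of_one_le_of_nonpos hr1.le (by linarith))

theorem rlIntegrand_comp_sub (α : ℝ) (u : ℝ → ℂ) (x r : ℝ) :
    rlIntegrand α u x (x - r) = ((r ^ (rlFrac α - 1) : ℝ) : ℂ) * u (x - r) := by
  simp [rlIntegrand, rlFrac]

theorem preimage_sub_Iio (x : ℝ) : (fun r => x - r) ⁻¹' Set.Iio x = Set.Ioi 0 := by
  ext r; simp

theorem measurableEmbedding_sub_left (x : ℝ) : MeasurableEmbedding fun r : ℝ => x - r :=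
  (Homeomorph.subLeft x).measurableEmbedding

theorem rlIntegral_eq_fracInt (α : ℝ) (u : ℝ → ℂ) :
    rlIntegral α u = fracInt (rlFrac α) u := by
  funext x
  rw [rlIntegral, ← (Measure.measurePreserving_sub_left volume x).setIntegral_preimage_emb
    (measurableEmbedding_sub_left x), preimage_sub_Iio]
  simp only [rlIntegrand_comp_sub, fracInt]

theorem integrableOn_rlIntegrand_iff (α : ℝ) (u : ℝ → ℂ) (x : ℝ) :
    IntegrableOn (rlIntegrand α u x) (Set.Iio x) ↔
      IntegrableOn (fun r : ℝ => ((r ^ (rlFrac α - 1) : ℝ) : ℂ) * u (x - r)) (Set.Ioi 0) := by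
  rw [← (Measure.measurePreserving_sub_left volume x).integrableOn_comp_preimage
    (measurableEmbedding_sub_left x), preimage_sub_Iio]
  simp only [Function.comp_def, rlIntegrand_comp_sub]

theorem exp_neg_I_mul_sub (ω x r : ℝ) (p : ℂ) :
    Complex.exp (-(p * r)) * Complex.exp (-(Complex.I * ω * (x - r : ℝ))) =
      Complex.exp (-((p - Complex.I * ω) * r)) * Complex.exp (-(Complex.I * ω * x)) := by
  rw [← Complex.exp_add, ← Complex.exp_add]
  congr 1
  push_cast
  ring

/-- The damped fractional integral of an oscillatory integral. -/
theorem integral_damped_oscInt {β ε : ℝ} (hβ : 0 < β) (hε : 0 < ε) {g : ℝ → ℂ}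
    (hg : Integrable g) (x : ℝ) :
    ∫ r in Set.Ioi (0 : ℝ),
        ((r ^ (β - 1) : ℝ) : ℂ) * Complex.exp (-((ε : ℂ) * r)) * oscInt g (x - r)
      = Real.Gamma β * oscInt (fun ω : ℝ => (ε - Complex.I * ω) ^ (-β : ℂ) * g ω) x := by
  -- The damping `e^{-εr}` makes the double integral absolutely convergent, so Fubini applies and
  -- Euler's integral with `p = ε - iω` evaluates the inner one.
  have hε' : 0 < (ε : ℂ).re := by simpa using hε
  have hint : Integrable (Function.uncurry fun (r ω : ℝ) =>
      ((r ^ (β - 1) : ℝ) : ℂ) * Complex.exp (-((ε : ℂ) * r)) *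
        (Complex.exp (-(Complex.I * ω * (x - r : ℝ))) * g ω))
      ((volume.restrict (Set.Ioi 0)).prod volume) := by
    have h := ((integrableOn_rpow_mul_cexp hβ hε').mul_prod hg).bdd_mul (c := 1)
      (f := fun z : ℝ × ℝ => Complex.exp (-(Complex.I * z.2 * (x - z.1 : ℝ))))
      (by fun_prop : Continuous _).aestronglyMeasurable
      (ae_of_all _ fun z => (norm_exp_neg_I_mul _ _).le)
    refine h.congr (ae_of_all _ fun z => ?_)
    simp only [Function.uncurry]
    ring
  calc _ = ∫ r in Set.Ioi (0 : ℝ), ∫ ω : ℝ,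
        ((r ^ (β - 1) : ℝ) : ℂ) * Complex.exp (-((ε : ℂ) * r)) *
          (Complex.exp (-(Complex.I * ω * (x - r : ℝ))) * g ω) := by
        simp only [oscInt, integral_const_mul]
    _ = ∫ ω : ℝ, ∫ r in Set.Ioi (0 : ℝ),
        ((r ^ (β - 1) : ℝ) : ℂ) * Complex.exp (-((ε : ℂ) * r)) *
          (Complex.exp (-(Complex.I * ω * (x - r : ℝ))) * g ω) := integral_integral_swap hint
    _ = ∫ ω : ℝ, Real.Gamma β *
        (Complex.exp (-(Complex.I * ω * x)) * ((ε - Complex.I * ω) ^ (-β : ℂ) * g ω)) := by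
        refine integral_congr_ae (ae_of_all _ fun ω => ?_)
        have e (r : ℝ) : ((r ^ (β - 1) : ℝ) : ℂ) * Complex.exp (-((ε : ℂ) * r)) *
            (Complex.exp (-(Complex.I * ω * (x - r : ℝ))) * g ω) =
            ((r ^ (β - 1) : ℝ) : ℂ) * Complex.exp (-((ε - Complex.I * ω) * r)) *
              (Complex.exp (-(Complex.I * ω * x)) * g ω) := by
          linear_combination (((r ^ (β - 1) : ℝ) : ℂ) * g ω) * exp_neg_I_mul_sub ω x r ε
        simp only [e]
        rw [integral_mul_const, integral_rpow_mul_cexp hβ (by simpa using hε)]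
        ring
    _ = _ := by rw [integral_const_mul, oscInt]

theorem norm_exp_neg_I_mul_sub_one_le (ω x : ℝ) :
    ‖Complex.exp (-(Complex.I * ω * x)) - 1‖ ≤ |x| * |ω| := by
  have h := Real.norm_exp_I_mul_ofReal_sub_one_le (x := -(ω * x))
  rw [norm_neg, norm_mul, Real.norm_eq_abs, Real.norm_eq_abs] at h
  rw [mul_comm |x|]
  refine le_trans (le_of_eq ?_) h
  congr 3
  push_cast
  ring

theorem abs_mul_rpow_neg {ω : ℝ} (hω : ω ≠ 0) (β : ℝ) : |ω| * |ω| ^ (-β) = |ω| ^ (1 - β) := by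
  rw [sub_eq_add_neg, Real.rpow_add (abs_pos.mpr hω), Real.rpow_one]

/-- The factor `e^{-iωx} - 1` gains one power of `|ω|`, and `|ε - iω| ≥ |ω|`. The majorant is free
of `ε`, as dominated convergence for `ε → 0` requires. -/
theorem norm_kernel_le {β : ℝ} (hβ : 0 < β) (g : ℝ → ℂ) (x ε : ℝ) {ω : ℝ} (hω : ω ≠ 0) :
    ‖(Complex.exp (-(Complex.I * ω * x)) - 1) * ((ε - Complex.I * ω) ^ (-β : ℂ) * g ω)‖
      ≤ |x| * (|ω| ^ (1 - β) * ‖g ω‖) := by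
  have h1 : ‖(ε - Complex.I * ω) ^ (-β : ℂ)‖ ≤ |ω| ^ (-β) := by
    rw [← Complex.ofReal_neg, Complex.norm_cpow_real]
    refine Real.rpow_le_rpow_of_nonpos (abs_pos.mpr hω) ?_ (by linarith)
    have := Complex.abs_im_le_norm (ε - Complex.I * ω)
    simpa using this
  rw [norm_mul, norm_mul, ← abs_mul_rpow_neg hω]
  calc _ ≤ |x| * |ω| * (|ω| ^ (-β) * ‖g ω‖) := by
        gcongr
        exact norm_exp_neg_I_mul_sub_one_le ω x
    _ = _ := by ring

/-- Difference form of the fractional integral of an oscillatory integral; it makes sense even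
when the low frequency singularity `|ω|^{-β}` is not integrable. -/
theorem fracInt_oscInt_sub {β : ℝ} (hβ : 0 < β) (hβ1 : β ≤ 1) {g : ℝ → ℂ} (hg : Integrable g)
    (hg' : Integrable fun ω : ℝ => |ω| ^ (1 - β) * ‖g ω‖) (hv : Integrable (oscInt g)) (x : ℝ) :
    fracInt β (oscInt g) x - fracInt β (oscInt g) 0 = Real.Gamma β *
      ∫ ω : ℝ, (Complex.exp (-(Complex.I * ω * x)) - 1) *
        ((-(Complex.I * ω)) ^ (-β : ℂ) * g ω) := by
  have hl (y : ℝ) : Tendsto (fun ε : ℝ => ∫ r in Set.Ioi (0 : ℝ),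
      ((r ^ (β - 1) : ℝ) : ℂ) * Complex.exp (-((ε : ℂ) * r)) * oscInt g (y - r)) (𝓝[>] 0)
      (𝓝 (fracInt β (oscInt g) y)) := by
    have hi := integrableOn_fracInt hβ hβ1 hv (norm_oscInt_le g) y
    refine tendsto_integral_filter_of_dominated_convergence _ ?_ ?_ hi.norm ?_
    · refine Eventually.of_forall fun ε => ?_
      have h := (by fun_prop : Continuous fun r : ℝ =>
        Complex.exp (-((ε : ℂ) * r))).aestronglyMeasurable.mul hi.aestronglyMeasurable
      refine h.congr (ae_of_all _ fun r => ?_)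
      simp only [Pi.mul_apply]
      ring
    · filter_upwards [self_mem_nhdsWithin] with ε hε
      filter_upwards [ae_restrict_mem measurableSet_Ioi] with r hr
      have hε : 0 < ε := hε
      have hr : 0 < r := hr
      rw [mul_right_comm, norm_mul]
      refine mul_le_of_le_one_right (norm_nonneg _) ?_
      rw [Complex.norm_exp]
      simp
      positivity
    · refine ae_of_all _ fun r => ?_
      have h : Continuous fun ε : ℝ =>
          ((r ^ (β - 1) : ℝ) : ℂ) * Complex.exp (-((ε : ℂ) * r)) * oscInt g (y - r) := by
        fun_prop
      simpa using (h.tendsto 0).mono_left (nhdsWithin_le_nhds (s := Set.Ioi 0))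
  have hr : Tendsto (fun ε : ℝ => ∫ ω : ℝ, (Complex.exp (-(Complex.I * ω * x)) - 1) *
      ((ε - Complex.I * ω) ^ (-β : ℂ) * g ω)) (𝓝[>] 0)
      (𝓝 (∫ ω : ℝ, (Complex.exp (-(Complex.I * ω * x)) - 1) *
        ((-(Complex.I * ω)) ^ (-β : ℂ) * g ω))) := by
    refine tendsto_integral_filter_of_dominated_convergence _ ?_ ?_ (hg'.const_mul |x|) ?_
    · refine Eventually.of_forall fun ε => ?_
      exact (by fun_prop : Continuous fun ω : ℝ =>
        Complex.exp (-(Complex.I * ω * x)) - 1).aestronglyMeasurable.mul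
        ((by fun_prop : Measurable fun ω : ℝ =>
          (ε - Complex.I * ω) ^ (-β : ℂ)).aestronglyMeasurable.mul hg.aestronglyMeasurable)
    · refine Eventually.of_forall fun ε => ?_
      filter_upwards [ae_ne_zero] with ω hω
      exact norm_kernel_le hβ g x ε hω
    · filter_upwards [ae_ne_zero] with ω hω
      refine Tendsto.const_mul _ (Tendsto.mul_const _ ?_)
      have hs : ((0 : ℝ) : ℂ) - Complex.I * ω ∈ Complex.slitPlane := Or.inr (by simpa using hω)
      have h : ContinuousAt (fun ε : ℝ => ((ε : ℂ) - Complex.I * ω) ^ (-β : ℂ)) 0 :=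
        ContinuousAt.cpow (f := fun ε : ℝ => (ε : ℂ) - Complex.I * ω) (by fun_prop)
          continuousAt_const hs
      simpa using h.tendsto.mono_left (nhdsWithin_le_nhds (s := Set.Ioi 0))
  -- The damped identity holds for each `ε > 0`; both of its sides converge as `ε → 0+`, so the
  -- limits agree.
  refine tendsto_nhds_unique ((hl x).sub (hl 0)) ((hr.const_mul _).congr' ?_)
  filter_upwards [self_mem_nhdsWithin] with ε hε
  have hε : 0 < ε := hε
  have hgε : Integrable fun ω : ℝ => (ε - Complex.I * ω) ^ (-β : ℂ) * g ω := by
    refine hg.bdd_mul (c := ε ^ (-β))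
      (by fun_prop : Measurable fun ω : ℝ => (ε - Complex.I * ω) ^ (-β : ℂ)).aestronglyMeasurable
      (ae_of_all _ fun ω => ?_)
    rw [← Complex.ofReal_neg, Complex.norm_cpow_real]
    refine Real.rpow_le_rpow_of_nonpos hε ?_ (by linarith)
    have := (le_abs_self _).trans (Complex.abs_re_le_norm (ε - Complex.I * ω))
    simpa using this
  rw [integral_damped_oscInt hβ hε hg, integral_damped_oscInt hβ hε hg, ← mul_sub, oscInt, oscInt,
    ← integral_sub (integrable_exp_mul hgε _) (integrable_exp_mul hgε _)]
  congr 1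
  refine integral_congr_ae (ae_of_all _ fun ω => ?_)
  simp
  ring

/-- A fractional integral of order `β ≤ 1` of an oscillatory integral is differentiable. -/
theorem hasDerivAt_fracInt_oscInt {β : ℝ} (hβ : 0 < β) (hβ1 : β ≤ 1) {g : ℝ → ℂ}
    (hg : Integrable g) (hg' : Integrable fun ω : ℝ => |ω| ^ (1 - β) * ‖g ω‖)
    (hv : Integrable (oscInt g)) (x : ℝ) :
    HasDerivAt (fracInt β (oscInt g))
      (Real.Gamma β * oscInt (fun ω : ℝ => (-(Complex.I * ω)) ^ ((1 - β : ℝ) : ℂ) * g ω) x) x := by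
  have hmeas (a : ℂ) : AEStronglyMeasurable fun ω : ℝ => (-(Complex.I * ω)) ^ a * g ω :=
    (measurable_neg_I_mul_cpow a).aestronglyMeasurable.mul hg.aestronglyMeasurable
  have hker (y : ℝ) : AEStronglyMeasurable fun ω : ℝ =>
      (Complex.exp (-(Complex.I * ω * y)) - 1) * ((-(Complex.I * ω)) ^ (-β : ℂ) * g ω) :=
    (by fun_prop : Continuous fun ω : ℝ =>
      Complex.exp (-(Complex.I * ω * y)) - 1).aestronglyMeasurable.mul (hmeas _)
  have hd := (hasDerivAt_integral_of_dominated_loc_of_deriv_le (μ := volume) (x₀ := x)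
    (F := fun (x : ℝ) (ω : ℝ) => (Complex.exp (-(Complex.I * ω * x)) - 1) *
        ((-(Complex.I * ω)) ^ (-β : ℂ) * g ω))
    (F' := fun (x : ℝ) (ω : ℝ) => Complex.exp (-(Complex.I * ω * x)) *
        ((-(Complex.I * ω)) ^ ((1 - β : ℝ) : ℂ) * g ω))
    (bound := fun ω => |ω| ^ (1 - β) * ‖g ω‖) univ_mem
    (Eventually.of_forall hker)
    ((hg'.const_mul |x|).mono' (hker x) ?_)
    ((by fun_prop : Continuous fun ω : ℝ =>
      Complex.exp (-(Complex.I * ω * x))).aestronglyMeasurable.mul (hmeas _))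
    (ae_of_all _ fun ω y _ => ?_) hg' ?_).2
  · have h := hd.const_mul (Real.Gamma β : ℂ)
    have e : fracInt β (oscInt g) = fun x : ℝ => fracInt β (oscInt g) 0 + Real.Gamma β *
      ∫ ω : ℝ, (Complex.exp (-(Complex.I * ω * x)) - 1) *
        ((-(Complex.I * ω)) ^ (-β : ℂ) * g ω) := by
      funext y
      rw [← fracInt_oscInt_sub hβ hβ1 hg hg' hv y]
      ring
    rw [e]
    exact h.const_add _
  · filter_upwards [ae_ne_zero] with ω hω
    simpa using norm_kernel_le hβ g x 0 hω
  · rw [norm_mul, norm_exp_neg_I_mul, one_mul, norm_mul, norm_neg_I_mul_cpow]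
  · filter_upwards [ae_ne_zero] with ω hω y _
    have h := ((hasDerivAt_exp_neg_I_mul ω y).sub_const 1).mul_const
      ((-(Complex.I * ω)) ^ (-β : ℂ) * g ω)
    have e : (-(Complex.I * ω)) ^ ((1 - β : ℝ) : ℂ) =
        -(Complex.I * ω) * (-(Complex.I * ω)) ^ (-β : ℂ) := by
      rw [Complex.ofReal_sub, Complex.ofReal_one, sub_eq_add_neg,
        Complex.cpow_add _ _ (neg_I_mul_ne_zero hω), Complex.cpow_one]
    rw [e]
    simpa only [mul_assoc] using h

theorem fracInt_congr_ae {β : ℝ} {u v : ℝ → ℂ} (h : u =ᵐ[volume] v) : fracInt β u = fracInt β v := by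
  funext x
  refine integral_congr_ae (ae_restrict_of_ae ?_)
  filter_upwards [(Measure.measurePreserving_sub_left volume x).quasiMeasurePreserving.ae_eq h]
    with r hr
  have hr : u (x - r) = v (x - r) := hr
  rw [hr]

theorem fracInt_const_mul (β : ℝ) (c : ℂ) (v : ℝ → ℂ) :
    (fracInt β fun x => c * v x) = fun x => c * fracInt β v x := by
  funext x
  rw [fracInt, fracInt, ← integral_const_mul]
  refine integral_congr_ae (ae_of_all _ fun r => ?_)
  ring

/-! ### Fourier representation of the Riemann–Liouville derivative -/

section

variable {α : ℝ} {u : ℝ → ℂ}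

theorem MemFourierClass.invHat_ae_eq (hα : 0 < α) (hu : MemFourierClass (2 + α) u) :
    invHat u =ᵐ[volume] u :=
  MidpointRL.invHat_ae_eq hu.integrable (hu.integrable_fourierHat (by linarith))

theorem MemFourierClass.integrable_oscInt (hα : 0 < α) (hu : MemFourierClass (2 + α) u) :
    Integrable (oscInt (fourierHat u)) := by
  have h := (hu.integrable.congr (hu.invHat_ae_eq hα).symm).const_mul ((2 * Real.pi : ℝ) : ℂ)
  refine h.congr (ae_of_all _ fun x => ?_)
  simp only [invHat_eq_oscInt]
  rw [← mul_assoc, ← Complex.ofReal_mul, mul_inv_cancel₀ (by positivity), Complex.ofReal_one,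
    one_mul]

theorem MemFourierClass.continuous_invHat (hα : 0 < α) (hu : MemFourierClass (2 + α) u) :
    Continuous (invHat u) :=
  (continuous_oscInt (hu.integrable_fourierHat (by linarith))).const_mul _

theorem norm_invHat_le (u : ℝ → ℂ) (x : ℝ) :
    ‖invHat u x‖ ≤ (2 * Real.pi)⁻¹ * ∫ ω, ‖fourierHat u ω‖ := by
  rw [invHat_eq_oscInt, norm_mul, Complex.norm_real, Real.norm_of_nonneg (by positivity)]
  gcongr
  exact norm_oscInt_le _ _

theorem MemFourierClass.rlIntegral_eq (hα : 0 < α) (hu : MemFourierClass (2 + α) u) :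
    rlIntegral α u = fun x =>
      ((2 * Real.pi)⁻¹ : ℝ) * fracInt (rlFrac α) (oscInt (fourierHat u)) x := by
  rw [rlIntegral_eq_fracInt, ← fracInt_congr_ae (hu.invHat_ae_eq hα), ← fracInt_const_mul]
  rfl

theorem MemFourierClass.integrableOn_rlIntegrand (hα : 0 < α) (hu : MemFourierClass (2 + α) u)
    (x : ℝ) : IntegrableOn (rlIntegrand α u x) (Set.Iio x) := by
  rw [integrableOn_rlIntegrand_iff]
  have h := integrableOn_fracInt rlFrac_pos (rlFrac_le_one hα)
    (hu.integrable.congr (hu.invHat_ae_eq hα).symm) (norm_invHat_le u) x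
  refine h.congr (ae_restrict_of_ae ?_)
  filter_upwards [(Measure.measurePreserving_sub_left volume x).quasiMeasurePreserving.ae_eq
    (hu.invHat_ae_eq hα)] with r hr
  have hr : invHat u (x - r) = u (x - r) := hr
  rw [hr]

theorem MemFourierClass.hasDerivAt_rlIntegral (hα : 0 < α) (hu : MemFourierClass (2 + α) u)
    (x : ℝ) :
    HasDerivAt (rlIntegral α u) (((2 * Real.pi)⁻¹ * Real.Gamma (rlFrac α) : ℝ) *
      oscInt (fun ω : ℝ => (-(Complex.I * ω)) ^ ((1 - rlFrac α : ℝ) : ℂ) * fourierHat u ω) x)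
      x := by
  have h1 : 0 ≤ 1 - rlFrac α := by linarith [rlFrac_le_one hα]
  have h2 : 1 - rlFrac α ≤ 2 + α := by linarith [rlFrac_pos (α := α)]
  rw [hu.rlIntegral_eq hα, Complex.ofReal_mul, mul_assoc]
  exact (hasDerivAt_fracInt_oscInt rlFrac_pos (rlFrac_le_one hα)
    (hu.integrable_fourierHat (by linarith)) (hu.integrable_rpow h1 h2)
    (hu.integrable_oscInt hα) x).const_mul _

/-- The total exponent is `k + α - ⌊α⌋ ≤ α + 1`, within the weight `2 + α`. -/
theorem MemFourierClass.integrable_pow_mul (hα : 0 < α) (hu : MemFourierClass (2 + α) u) {k : ℕ}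
    (hk : k ≤ ⌊α⌋₊ + 1) : Integrable fun ω : ℝ => (-(Complex.I * ω)) ^ k *
      ((-(Complex.I * ω)) ^ ((1 - rlFrac α : ℝ) : ℂ) * fourierHat u ω) := by
  have h1 := rlFrac_le_one hα
  have hk' : (k : ℝ) ≤ ⌊α⌋₊ + 1 := by exact_mod_cast hk
  refine (hu.integrable_cpow (a := k + (1 - rlFrac α)) ?_ ?_).congr
    (pow_mul_cpow_ae_eq _ _ _).symm
  · have : (0 : ℝ) ≤ k := k.cast_nonneg
    linarith
  · unfold rlFrac rlOrder
    push_cast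
    linarith

theorem MemFourierClass.deriv_rlIntegral (hα : 0 < α) (hu : MemFourierClass (2 + α) u) :
    deriv (rlIntegral α u) = fun x => ((2 * Real.pi)⁻¹ * Real.Gamma (rlFrac α) : ℝ) *
      oscInt (fun ω : ℝ => (-(Complex.I * ω)) ^ ((1 - rlFrac α : ℝ) : ℂ) * fourierHat u ω) x :=
  funext fun x => (hu.hasDerivAt_rlIntegral hα x).deriv

theorem MemFourierClass.contDiff_rlIntegral (hα : 0 < α) (hu : MemFourierClass (2 + α) u) :
    ContDiff ℝ (rlOrder α : ℕ) (rlIntegral α u) := by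
  unfold rlOrder
  push_cast
  rw [contDiff_succ_iff_deriv]
  refine ⟨fun x => (hu.hasDerivAt_rlIntegral hα x).differentiableAt, by simp, ?_⟩
  rw [hu.deriv_rlIntegral hα]
  exact contDiff_const.mul (contDiff_oscInt fun k hk => hu.integrable_pow_mul hα hk)

/-- Fourier representation of the Riemann–Liouville derivative. -/
theorem MemFourierClass.rlDeriv_eq (hα : 0 < α) (hu : MemFourierClass (2 + α) u) (t : ℝ) :
    rlDeriv α u t = ((2 * Real.pi)⁻¹ : ℝ) *
      oscInt (fun ω : ℝ => (-(Complex.I * ω)) ^ (α : ℂ) * fourierHat u ω) t := by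
  have hΓ : Real.Gamma (rlFrac α) ≠ 0 := (Real.Gamma_pos_of_pos rlFrac_pos).ne'
  have h := oscInt_congr_ae (pow_mul_cpow_ae_eq (fourierHat u) ⌊α⌋₊ (1 - rlFrac α))
  have e : (⌊α⌋₊ : ℝ) + (1 - rlFrac α) = α := by
    unfold rlFrac rlOrder
    push_cast
    ring
  rw [e] at h
  have h2 : iteratedDeriv (rlOrder α) (rlIntegral α u) t =
      ((2 * Real.pi)⁻¹ * Real.Gamma (rlFrac α) : ℝ) *
        oscInt (fun ω : ℝ => (-(Complex.I * ω)) ^ (α : ℂ) * fourierHat u ω) t := by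
    -- The innermost derivative is the one through the fractional integral; the remaining `⌊α⌋` act
    -- on an oscillatory integral and raise the exponent from `α - ⌊α⌋` to `α`.
    rw [rlOrder, iteratedDeriv_succ', hu.deriv_rlIntegral hα, iteratedDeriv_const_mul_field,
      iteratedDeriv_oscInt (N := ⌊α⌋₊ + 1) (fun k hk => hu.integrable_pow_mul hα hk) (by omega), h]
  rw [rlDeriv, h2, ← mul_assoc, ← Complex.ofReal_mul]
  congr 2
  change 1 / Real.Gamma (rlFrac α) * _ = _
  field_simp

/-! ### The difference operator and the error estimate -/

theorem summable_weight_mul_invHat (hα : 0 < α) (u : ℝ → ℂ) (t τ : ℝ) :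
    Summable fun l : ℕ => weight α l * invHat u (t - l * τ) := by
  refine Summable.of_norm_bounded ((summable_norm_weight hα).mul_right
    ((2 * Real.pi)⁻¹ * ∫ ω, ‖fourierHat u ω‖)) fun l => ?_
  rw [norm_mul]
  gcongr
  exact norm_invHat_le _ _

theorem exp_neg_I_mul_sub_nat (ω t τ : ℝ) (l : ℕ) :
    Complex.exp (-(Complex.I * ω * (t - l * τ : ℝ))) =
      Complex.exp (-(Complex.I * ω * t)) * Complex.exp (Complex.I * (ω * τ : ℝ)) ^ l := by
  rw [← Complex.exp_nat_mul, ← Complex.exp_add]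
  congr 1
  push_cast
  ring

/-- Fourier representation of the difference operator. -/
theorem MemFourierClass.tsum_weight_mul (hα : 0 < α) (hu : MemFourierClass (2 + α) u) (t τ : ℝ) :
    ∑' l : ℕ, weight α l * invHat u (t - l * τ) = ((2 * Real.pi)⁻¹ : ℝ) *
      oscInt (fun ω : ℝ => genFun α (Complex.exp (Complex.I * (ω * τ : ℝ))) * fourierHat u ω)
        t := by
  have hg := hu.integrable_fourierHat (by linarith)
  have hint (l : ℕ) : Integrable fun ω : ℝ =>
      weight α l * (Complex.exp (-(Complex.I * ω * (t - l * τ : ℝ))) * fourierHat u ω) :=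
    (integrable_exp_mul hg _).const_mul _
  -- Sum and integral are exchanged using `∑ |ϖ_l| < ∞` and `û ∈ L¹`.
  have h := hasSum_integral_of_summable_integral_norm hint (by
    simp only [norm_mul, norm_exp_neg_I_mul, one_mul, integral_const_mul]
    exact (summable_norm_weight hα).mul_right _)
  simp only [integral_const_mul] at h
  have h2 := (h.mul_left (((2 * Real.pi)⁻¹ : ℝ) : ℂ)).tsum_eq
  refine Eq.trans ?_ (h2.trans ?_)
  · refine tsum_congr fun l => ?_
    rw [invHat]
    ring
  · congr 1
    refine integral_congr_ae (ae_of_all _ fun ω => ?_)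
    have hs := (hasSum_weight_closedBall hα
      (norm_exp_I_mul_real (ω * τ)).le).mul_right
        (Complex.exp (-(Complex.I * ω * t)) * fourierHat u ω)
    refine Eq.trans (tsum_congr fun l => ?_) (hs.tsum_eq.trans ?_)
    · rw [exp_neg_I_mul_sub_nat]
      ring
    · ring

theorem symbol_scaling {τ : ℝ} (hτ : 0 < τ) (ω α : ℝ) :
    (-(Complex.I * ω)) ^ (α : ℂ) =
      ((τ ^ (-α) : ℝ) : ℂ) * (-(Complex.I * (ω * τ : ℝ))) ^ (α : ℂ) := by
  rcases eq_or_ne ω 0 with rfl | hω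
  · rcases eq_or_ne α 0 with rfl | hα
    · simp
    · simp [hα]
  · have e : -(Complex.I * (ω * τ : ℝ)) = (τ : ℂ) * -(Complex.I * ω) := by push_cast; ring
    have ht : (τ : ℂ) ≠ 0 := by exact_mod_cast hτ.ne'
    have hm : ((τ : ℂ) * -(Complex.I * ω)) ^ (α : ℂ) =
        (τ : ℂ) ^ (α : ℂ) * (-(Complex.I * ω)) ^ (α : ℂ) := by
      rw [Complex.cpow_def_of_ne_zero (mul_ne_zero ht (neg_I_mul_ne_zero hω)),
        Complex.cpow_def_of_ne_zero ht, Complex.cpow_def_of_ne_zero (neg_I_mul_ne_zero hω),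
        Complex.log_ofReal_mul hτ (neg_I_mul_ne_zero hω), Complex.ofReal_log hτ.le, add_mul,
        Complex.exp_add]
    rw [e, hm, ← Complex.ofReal_cpow hτ.le, ← mul_assoc, ← Complex.ofReal_mul,
      ← Real.rpow_add hτ]
    simp

theorem symbol_difference_bound {K : ℝ} (hK : ∀ y : ℝ, y ≠ 0 →
      ‖(-(Complex.I * y)) ^ (α : ℂ) * Complex.exp (-(Complex.I * y) / 2)
        - genFun α (Complex.exp (Complex.I * y))‖ ≤ K * |y| ^ (2 + α))
    {τ : ℝ} (hτ : 0 < τ) {ω : ℝ} (hω : ω ≠ 0) :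
    ‖(-(Complex.I * ω)) ^ (α : ℂ) * Complex.exp (-(Complex.I * (ω * τ : ℝ)) / 2)
      - ((τ ^ (-α) : ℝ) : ℂ) * genFun α (Complex.exp (Complex.I * (ω * τ : ℝ)))‖
      ≤ K * τ ^ 2 * |ω| ^ (2 + α) := by
  have h := hK (ω * τ) (mul_ne_zero hω hτ.ne')
  rw [symbol_scaling hτ, mul_assoc, ← mul_sub, norm_mul, Complex.norm_real,
    Real.norm_of_nonneg (by positivity)]
  calc _ ≤ τ ^ (-α) * (K * |ω * τ| ^ (2 + α)) := by gcongr
    _ = K * (τ ^ (-α) * τ ^ (2 + α)) * |ω| ^ (2 + α) := by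
      rw [abs_mul, abs_of_pos hτ, Real.mul_rpow (abs_nonneg _) hτ.le]
      ring
    _ = _ := by
      rw [← Real.rpow_add hτ]
      norm_num

theorem exists_rlDeriv_sub_diffOp_bound (hα : 0 < α) (hu : MemFourierClass (2 + α) u) :
    ∃ C : ℝ, ∀ τ : ℝ, 0 < τ → ∀ t : ℝ,
      ‖rlDeriv α u (t + τ / 2) - diffOp α τ (invHat u) t‖ ≤ C * τ ^ 2 := by
  obtain ⟨K, hK0, hK⟩ := exists_symbol_bound hα
  refine ⟨(2 * Real.pi)⁻¹ * (K * ∫ ω : ℝ, |ω| ^ (2 + α) * ‖fourierHat u ω‖), fun τ hτ t => ?_⟩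
  have hg := hu.integrable_fourierHat (by linarith)
  have i1 := integrable_exp_mul (hu.integrable_cpow hα.le (by linarith)) (t + τ / 2)
  have i2 : Integrable fun ω : ℝ =>
      genFun α (Complex.exp (Complex.I * (ω * τ : ℝ))) * fourierHat u ω := by
    refine hg.bdd_mul (c := ∑' l : ℕ, ‖weight α l‖) ?_
      (ae_of_all _ fun ω => norm_genFun_le hα (norm_exp_I_mul_real _).le)
    refine Continuous.aestronglyMeasurable ?_
    exact (continuousOn_genFun hα).comp_continuous (by fun_prop)
      fun ω => by simpa using (norm_exp_I_mul_real (ω * τ)).le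
  have i3 := (integrable_exp_mul i2 t).const_mul ((τ ^ (-α) : ℝ) : ℂ)
  rw [hu.rlDeriv_eq hα, diffOp, hu.tsum_weight_mul hα, mul_left_comm, ← mul_sub, norm_mul,
    Complex.norm_real, Real.norm_of_nonneg (by positivity), mul_assoc, oscInt, oscInt,
    ← integral_const_mul, ← integral_sub i1 i3]
  gcongr
  rw [mul_right_comm, ← integral_const_mul]
  refine norm_integral_le_of_norm_le
    ((hu.integrable_rpow (by linarith) le_rfl).const_mul _) ?_
  filter_upwards [ae_ne_zero] with ω hω
  have e : Complex.exp (-(Complex.I * ω * (t + τ / 2 : ℝ))) =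
      Complex.exp (-(Complex.I * ω * t)) * Complex.exp (-(Complex.I * (ω * τ : ℝ)) / 2) := by
    rw [← Complex.exp_add]
    congr 1
    push_cast
    ring
  have h := symbol_difference_bound hK hτ hω
  calc _ = ‖Complex.exp (-(Complex.I * ω * t)) *
        (((-(Complex.I * ω)) ^ (α : ℂ) * Complex.exp (-(Complex.I * (ω * τ : ℝ)) / 2)
      - ((τ ^ (-α) : ℝ) : ℂ) * genFun α (Complex.exp (Complex.I * (ω * τ : ℝ)))) *
        fourierHat u ω)‖ := by
        congr 1
        rw [e]
        ring
    _ ≤ K * τ ^ 2 * |ω| ^ (2 + α) * ‖fourierHat u ω‖ := by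
        rw [norm_mul, norm_exp_neg_I_mul, one_mul, norm_mul]
        gcongr
    _ = _ := by ring

end

/-! ### From the continuous representative back to `u` -/

/-- The exceptional set is a countable union of translates of a null set. -/
theorem ae_forall_sub_nat_mul {u v : ℝ → ℂ} (h : v =ᵐ[volume] u) (τ : ℝ) :
    ∀ᵐ t : ℝ, ∀ l : ℕ, v (t - l * τ) = u (t - l * τ) :=
  ae_all_iff.mpr fun l =>
    (measurePreserving_sub_right volume ((l : ℝ) * τ)).quasiMeasurePreserving.ae_eq h

end MidpointRL

theorem mainTheorem1 (α : ℝ) (hα : 0 < α) :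
    (∀ z : ℂ, ‖z‖ < 1 →
      HasSum (fun l : ℕ => MidpointRL.weight α l * z ^ l) (MidpointRL.genFun α z)) ∧
    ∀ u : ℝ → ℂ, MidpointRL.MemFourierClass (2 + α) u →
      (∀ x : ℝ, IntegrableOn (MidpointRL.rlIntegrand α u x) (Set.Iio x)) ∧
      ContDiff ℝ (MidpointRL.rlOrder α : ℕ) (MidpointRL.rlIntegral α u) ∧
      ∃ C : ℝ, ∀ τ : ℝ, 0 < τ →
        (∀ᵐ t : ℝ,
          Summable (fun l : ℕ => MidpointRL.weight α l * u (t - (l : ℝ) * τ)) ∧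
          ‖MidpointRL.rlDeriv α u (t + τ / 2) - MidpointRL.diffOp α τ u t‖ ≤ C * τ ^ 2) ∧
        (Continuous u → ∀ t : ℝ,
          Summable (fun l : ℕ => MidpointRL.weight α l * u (t - (l : ℝ) * τ)) ∧
          ‖MidpointRL.rlDeriv α u (t + τ / 2) - MidpointRL.diffOp α τ u t‖ ≤ C * τ ^ 2) := by
  refine ⟨fun z hz => MidpointRL.hasSum_weight hα hz, fun u hu =>
    ⟨hu.integrableOn_rlIntegrand hα, hu.contDiff_rlIntegral hα, ?_⟩⟩
  obtain ⟨C, hC⟩ := MidpointRL.exists_rlDeriv_sub_diffOp_bound hα hu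
  -- `rlDeriv` is already computed for `u` itself; only the sampled values in the difference
  -- operator depend on the representative.
  have key (τ : ℝ) (hτ : 0 < τ) (t : ℝ)
      (h : ∀ l : ℕ, MidpointRL.invHat u (t - l * τ) = u (t - l * τ)) :
      Summable (fun l : ℕ => MidpointRL.weight α l * u (t - (l : ℝ) * τ)) ∧
        ‖MidpointRL.rlDeriv α u (t + τ / 2) - MidpointRL.diffOp α τ u t‖ ≤ C * τ ^ 2 := by
    have h1 := MidpointRL.summable_weight_mul_invHat hα u t τ
    have h2 := hC τ hτ t
    simp only [MidpointRL.diffOp, h] at h1 h2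
    exact ⟨h1, h2⟩
  refine ⟨C, fun τ hτ => ⟨?_, fun hcont t => key τ hτ t fun l => ?_⟩⟩
  · filter_upwards [MidpointRL.ae_forall_sub_nat_mul (hu.invHat_ae_eq hα) τ] with t ht
    exact key τ hτ t ht
  · rw [((hu.continuous_invHat hα).ae_eq_iff_eq volume hcont).mp (hu.invHat_ae_eq hα)]
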